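/- Model. There are $K$ arms with unknown thresholds $\nu=(\nu_1,\dots,\nu_K)$, $\nu_k>0$. In each round $t=1,2,\dots$ an algorithm $A$, which may be randomized and does not know a horizon (anytime), chooses allocations $M_{k,t}\ge 0$ with $\sum_k M_{k,t}\le 1$ on the basis of the past outcomes and its internal randomness; given the past, the arms then succeed ($X_{k,t}=1$) or fail ($X_{k,t}=0$) independently, with $\Pr[X_{k,t}=1]=\min\{1,M_{k,t}/\nu_k\}$. The optimal allocation for $\nu$ serves the arms in increasing order of their thresholds, giving each one the minimum of its threshold and the resource that is left. If $r^*(\nu)$ is its expected one-round reward, the regret is $R^{(n)}(A,\nu)=n\,r^*(\nu)-\sum_{t=1}^n\sum_{k=1}^K X_{k,t}$. Theorem. Fix integers $\ell\ge 0$ and $K>\ell+1$, and numbers $v_1,\dots,v_\ell>0$ with $v_1+\dots+v_\ell<1$. Let $B$ be the set of all $\nu\in\mathbb R^K$ such that $\nu_k=v_k$ for all $k\le\ell$ and $\nu_k>1$ for all $\ell<k\le K$. For $\nu\in B$ put $\nu^*=\min_{\ell+1\le k\le K}\nu_k$; let $D(p\|q)=p\log\frac pq+(1-p)\log\frac{1-p}{1-q}$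 and, for $a>1$, $$C(a)=\min\left(\frac{4(1-a^{-1})^2}{4(1-a^{-1})^2+1},\ \frac{a^{-1}}{-4\log(1-a^{-1})}\right).$$ Let $A$ be an anytime algorithm such that $\lim_{n\to\infty}\mathbb E R^{(n)}(A,\nu)/n^a=0$ for all $\nu\in B$ and all $a>0$. Then, for all $\nu\in B$, $$\liminf_{n\to\infty}\frac{\mathbb E R^{(n)}(A,\nu)}{\log n}\ \ge\sum_{\ell<k\le K,\ \nu_k>\nu^*}\frac{1/\nu^*-1/\nu_k}{D(1/\nu_k\,\|\,1/\nu^*)}\ \ge\ C(\nu^*)\sum_{\ell<k\le K,\ \nu_k\ne\nu^*}\frac{\nu_k}{\nu_k-\nu^*}.$$ -/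

import Mathlib

open Filter Topology MeasureTheory

noncomputable section

namespace Allocation

/-- Success probability of an arm with threshold `ν > 0` that is allocated the amount `M ≥ 0`. -/
def successProb (ν M : ℝ) : ℝ := min 1 (M / ν)

/-- Probability of the outcome `b` (`true` = success) of such an arm. -/
def outcomeProb (ν M : ℝ) (b : Bool) : ℝ :=
  if b then successProb ν M else 1 - successProb ν M

/-- The recursion `M*_k = min (ν_k) (1 - ∑_{i < k} M*_i)`, to be applied to thresholds that are
listed in increasing order. -/
def greedyAllocation {K : ℕ} (ν : Fin K → ℝ) (k : Fin K) : ℝ :=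
  min (ν k) (1 - ∑ i : Fin k.val, greedyAllocation ν ⟨i.val, i.isLt.trans k.isLt⟩)
termination_by k.val
decreasing_by exact i.isLt

/-- The expected one-round reward of the optimal allocation: the thresholds are put in increasing
order, and the arms are then served greedily. -/
def optReward {K : ℕ} (ν : Fin K → ℝ) : ℝ :=
  ∑ k : Fin K, successProb ((ν ∘ Tuple.sort ν) k) (greedyAllocation (ν ∘ Tuple.sort ν) k)

/-- Success indicators of all arms in the first `n` rounds; round `t + 1` has the index `t`. -/
abbrev Outcomes (K n : ℕ) : Type := Fin n → Fin K → Bool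

/-- The outcomes of the rounds before round `t`. -/
def Outcomes.before {K n : ℕ} (x : Outcomes K n) (t : Fin n) : Outcomes K t.val :=
  fun i => x ⟨i.val, i.isLt.trans t.isLt⟩

/-- An anytime, possibly randomized, allocation algorithm for `K` arms. All of its internal
randomness is contained in a seed from `S`. The allocation of a round depends on the seed and on
the outcomes of the earlier rounds only (the earlier allocations are functions of these); neither
the horizon nor the thresholds are an input. -/
structure Algorithm (K : ℕ) (S : Type*) [MeasurableSpace S] where
  alloc : (t : ℕ) → S → Outcomes K t → Fin K → ℝ
  measurable_alloc : ∀ t x k, Measurable fun s => alloc t s x k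
  alloc_nonneg : ∀ t s x k, 0 ≤ alloc t s x k
  sum_alloc_le_one : ∀ t s x, ∑ k, alloc t s x k ≤ 1

variable {K : ℕ} {S : Type*} [MeasurableSpace S]

/-- The conditional probability, given the seed `s`, that the outcomes of the first `n` rounds are
`x`: in each round, given the past, the arms succeed independently of each other, with the
probabilities determined by the current allocation. -/
def pathProb (A : Algorithm K S) (ν : Fin K → ℝ) (s : S) {n : ℕ} (x : Outcomes K n) : ℝ :=
  ∏ t : Fin n, ∏ k : Fin K, outcomeProb (ν k) (A.alloc t.val s (x.before t) k) (x t k)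

/-- The regret after `n` rounds with the outcomes `x`. -/
def regret (ν : Fin K → ℝ) {n : ℕ} (x : Outcomes K n) : ℝ :=
  n * optReward ν - ∑ t : Fin n, ∑ k : Fin K, if x t k then (1 : ℝ) else 0

/-- The expected regret of `A` after `n` rounds, the seed having the law `ρ`. -/
def expectedRegret (A : Algorithm K S) (ρ : Measure S) (ν : Fin K → ℝ) (n : ℕ) : ℝ :=
  ∫ s, ∑ x : Outcomes K n, pathProb A ν s x * regret ν x ∂ρ

/-- The vectors whose first `l` entries are given by `v` and whose other entries exceed `1`. -/
def instances (K l : ℕ) (v : Fin l → ℝ) : Set (Fin K → ℝ) :=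
  {ν | (∀ (k : Fin K) (h : k.val < l), ν k = v ⟨k.val, h⟩) ∧ ∀ k : Fin K, l ≤ k.val → 1 < ν k}

/-- The minimum of the thresholds of the arms after the first `l` (a finite index set, nonempty
if `l < K`). -/
def minRest (l : ℕ) (ν : Fin K → ℝ) : ℝ := ⨅ k : {k : Fin K // l ≤ k.val}, ν k

/-- The relative entropy of the Bernoulli laws with parameters `p` and `q`. -/
def bernoulliKL (p q : ℝ) : ℝ :=
  p * Real.log (p / q) + (1 - p) * Real.log ((1 - p) / (1 - q))

/-- The factor in the second lower bound. -/
def factorC (a : ℝ) : ℝ :=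
  min (4 * (1 - a⁻¹) ^ 2 / (4 * (1 - a⁻¹) ^ 2 + 1)) (a⁻¹ / (-4 * Real.log (1 - a⁻¹)))

end Allocation

end

open Allocation

noncomputable section

namespace Allocation

/-! Write `a` for the least threshold beyond the first `l` arms and `R` for the resource that those
arms leave. Pricing the resource at `1/a` shows that each unit given to an arm `k` with `ν k > a`
costs at least `1/a - 1/ν k` of regret (`sum_gap_mul_expectedAlloc_le`). It remains to show that
such an arm must receive about `log n / D(1/ν k ‖ 1/a)` in total. This is a change of measure. Lower
`ν k` to some `b` in `(1, a)`, which makes arm `k` the best one for the remainder. Let `W` be the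
normalized sum of the shortfalls `(R - M_k)⁺`. If arm `k` is served little, `W` has mean near 1
under `ν`; under the modified thresholds its mean is at most a multiple of regret over `n`. A
Donsker–Varadhan type inequality (`mul_pathMean_le`) compares the two means at the price of the
relative entropy of the path laws. That entropy is at most `D(1/ν k ‖ 1/b)` times the expected total
allocation to `k`, since an allocation `M ≤ 1` thins the Bernoulli outcome (`bernoulliKL_mul_le`).
With the parameter `β log n`, `β < 1`, the subpolynomial regret makes the error bounded
(`mul_one_sub_le`); then `b → a` and `β → 1`. The second inequality holds term by term, by bounding
relative entropy by the chi-square divergence (`factorC_mul_le`). -/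

/-! ### The greedy allocation -/

theorem sum_fin_eq_sum_ite {K m : ℕ} (h : m ≤ K) (f : Fin K → ℝ) :
    ∑ i : Fin m, f ⟨i.val, i.isLt.trans_le h⟩ = ∑ j : Fin K, if j.val < m then f j else 0 := by
  obtain ⟨d, rfl⟩ := Nat.exists_eq_add_of_le h
  rw [Fin.sum_univ_add]
  simp [Fin.castAdd, Fin.castLE]

theorem greedyAllocation_le {K : ℕ} (μ : Fin K → ℝ) (k : Fin K) :
    greedyAllocation μ k ≤
      1 - ∑ i : Fin k.val, greedyAllocation μ ⟨i.val, i.isLt.trans k.isLt⟩ := by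
  rw [greedyAllocation]
  exact min_le_right _ _

theorem sum_greedyAllocation_le_one {K : ℕ} (μ : Fin K → ℝ) (m : ℕ) (h : m ≤ K) :
    ∑ i : Fin m, greedyAllocation μ ⟨i.val, i.isLt.trans_le h⟩ ≤ 1 := by
  cases m with
  | zero => simp
  | succ m =>
    rw [Fin.sum_univ_castSucc]
    have := greedyAllocation_le μ ⟨m, h⟩
    simp only [Fin.val_castSucc, Fin.val_last]
    linarith

theorem greedyAllocation_nonneg {K : ℕ} {μ : Fin K → ℝ} (hμ : ∀ k, 0 ≤ μ k) (k : Fin K) :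
    0 ≤ greedyAllocation μ k := by
  rw [greedyAllocation]
  exact le_min (hμ k) (sub_nonneg.2 (sum_greedyAllocation_le_one μ k.val k.isLt.le))

theorem greedyAllocation_eq_self {K l : ℕ} (hl : l ≤ K) {μ : Fin K → ℝ} (hμ : ∀ k, 0 ≤ μ k)
    (hsum : ∑ i : Fin l, μ ⟨i.val, i.isLt.trans_le hl⟩ ≤ 1) (m : ℕ) (hm : m < l) :
    greedyAllocation μ ⟨m, hm.trans_le hl⟩ = μ ⟨m, hm.trans_le hl⟩ := by
  induction m using Nat.strong_induction_on with
  | _ m ih =>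
    rw [greedyAllocation]
    apply min_eq_left
    have h1 : ∑ i : Fin m, greedyAllocation μ ⟨i.val, (i.isLt.trans hm).trans_le hl⟩
        = ∑ i : Fin m, μ ⟨i.val, (i.isLt.trans hm).trans_le hl⟩ :=
      Finset.sum_congr rfl fun i _ => ih i.val i.isLt (i.isLt.trans hm)
    have h2 : ∑ i : Fin (m + 1), μ ⟨i.val, i.isLt.trans_le (hm.trans_le hl)⟩
        ≤ ∑ i : Fin l, μ ⟨i.val, i.isLt.trans_le hl⟩ := by
      rw [sum_fin_eq_sum_ite hl, sum_fin_eq_sum_ite (hm.trans_le hl)]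
      refine Finset.sum_le_sum fun j _ => ?_
      have := hμ j
      split_ifs <;> first | omega | linarith
    rw [Fin.sum_univ_castSucc] at h2
    simp only [Fin.val_castSucc, Fin.val_last] at h2
    simp only [h1]
    linarith

theorem successProb_nonneg {ν M : ℝ} (hν : 0 < ν) (hM : 0 ≤ M) : 0 ≤ successProb ν M :=
  le_min zero_le_one (div_nonneg hM hν.le)

/-! ### Bounds on the one-round reward -/

section Instances

variable {K l : ℕ} {v : Fin l → ℝ} {ν : Fin K → ℝ}

theorem sum_ite_eq_of_mem_instances (hlK : l ≤ K) (hν : ν ∈ instances K l v) :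
    ∑ k : Fin K, (if k.val < l then ν k else 0) = ∑ i, v i := by
  rw [← sum_fin_eq_sum_ite hlK]
  exact Finset.sum_congr rfl fun i _ => hν.1 _ i.isLt

theorem pos_of_mem_instances (hv_pos : ∀ k, 0 < v k) (hν : ν ∈ instances K l v) (k : Fin K) :
    0 < ν k := by
  by_cases h : k.val < l
  · rw [hν.1 k h]; exact hv_pos _
  · linarith [hν.2 k (not_lt.1 h)]

theorem lt_one_of_mem_instances (hv_pos : ∀ k, 0 < v k) (hv_sum : ∑ k, v k < 1)
    (hν : ν ∈ instances K l v) {k : Fin K} (h : k.val < l) : ν k < 1 := by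
  rw [hν.1 k h]
  exact (Finset.single_le_sum (fun i _ => (hv_pos i).le) (Finset.mem_univ _)).trans_lt hv_sum

theorem le_one_iff_of_mem_instances (hv_pos : ∀ k, 0 < v k) (hv_sum : ∑ k, v k < 1)
    (hν : ν ∈ instances K l v) (k : Fin K) : ν k ≤ 1 ↔ k.val < l :=
  ⟨fun h => by
    by_contra h'
    linarith [hν.2 k (not_lt.1 h')],
   fun h => (lt_one_of_mem_instances hv_pos hv_sum hν h).le⟩

/-- Sorting moves the `l` arms with thresholds at most 1 to the front. They are served in full, and
the next arm, whose threshold is at most `ν k`, takes the whole remainder. Only this lower bound on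
the optimum is needed. -/
theorem le_optReward (hv_pos : ∀ k, 0 < v k) (hv_sum : ∑ k, v k < 1)
    (hν : ν ∈ instances K l v) (k : Fin K) (hk : l ≤ k.val) :
    l + (1 - ∑ i, v i) / ν k ≤ optReward ν := by
  have hlK : l < K := hk.trans_lt k.isLt
  set σ := Tuple.sort ν with hσ
  set μ := ν ∘ σ with hμdef
  have hmono : Monotone μ := Tuple.monotone_sort ν
  have hpos : ∀ j, 0 < μ j := fun j => pos_of_mem_instances hv_pos hν _
  -- Counting the thresholds that are at most 1 identifies the first `l` sorted positions with the
  -- first `l` arms, in some order.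
  have hcard : Fintype.card {i // μ i ≤ 1} = l := by
    have e : {i // μ i ≤ 1} ≃ Fin l :=
      (σ.subtypeEquiv (p := fun i => μ i ≤ 1) (q := fun i => i.val < l)
        fun i => le_one_iff_of_mem_instances hv_pos hv_sum hν (σ i)).trans
      { toFun := fun i => ⟨i.1.val, i.2⟩
        invFun := fun i => ⟨⟨i.val, i.isLt.trans hlK⟩, i.isLt⟩
        left_inv := fun _ => rfl
        right_inv := fun _ => rfl }
    simpa using Fintype.card_congr e
  have hiff : ∀ j : Fin K, j.val < l ↔ (σ j).val < l := fun j => by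
    rw [← le_one_iff_of_mem_instances hv_pos hv_sum hν (σ j)]
    have := Tuple.lt_card_le_iff_apply_le_of_monotone (j := j) (f := μ) (a := 1) hmono
    rw [← Fintype.card_subtype, hcard] at this
    exact this
  have hsum : ∑ i : Fin l, μ ⟨i.val, i.isLt.trans_le hlK.le⟩ = ∑ i, v i := by
    rw [sum_fin_eq_sum_ite hlK.le, ← sum_ite_eq_of_mem_instances hlK.le hν,
      ← Equiv.sum_comp σ (fun k : Fin K => if k.val < l then ν k else 0)]
    exact Finset.sum_congr rfl fun j _ => by simp only [hiff j, hμdef, Function.comp]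
  have hself := greedyAllocation_eq_self hlK.le (fun j => (hpos j).le) (hsum.trans_le hv_sum.le)
  have hlast : greedyAllocation μ ⟨l, hlK⟩ = min (μ ⟨l, hlK⟩) (1 - ∑ i, v i) := by
    rw [greedyAllocation, ← hsum]
    congr 2
    exact Finset.sum_congr rfl fun i _ => hself i.val i.isLt
  have hv0 : 0 ≤ ∑ i, v i := Finset.sum_nonneg fun i _ => (hv_pos i).le
  have hμl : 1 < μ ⟨l, hlK⟩ :=
    hν.2 _ (not_lt.1 fun h => lt_irrefl l ((hiff ⟨l, hlK⟩).2 h))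
  have hle : μ ⟨l, hlK⟩ ≤ ν k := by
    have : (⟨l, hlK⟩ : Fin K) ≤ σ.symm k := by
      rw [Fin.le_def]
      refine not_lt.1 fun h => ?_
      have := (hiff _).1 h
      simp at this
      omega
    simpa [hμdef] using hmono this
  have hnn : ∀ j, 0 ≤ successProb (μ j) (greedyAllocation μ j) := fun j =>
    successProb_nonneg (hpos j) (greedyAllocation_nonneg (fun j => (hpos j).le) j)
  have hreward : ∑ i : Fin (l + 1), successProb (μ ⟨i.val, i.isLt.trans_le hlK⟩)
      (greedyAllocation μ ⟨i.val, i.isLt.trans_le hlK⟩) ≤ optReward ν := by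
    rw [sum_fin_eq_sum_ite hlK (fun j => successProb (μ j) (greedyAllocation μ j)), optReward]
    refine Finset.sum_le_sum fun j _ => ?_
    split_ifs
    · exact le_rfl
    · exact hnn j
  refine le_trans ?_ hreward
  rw [Fin.sum_univ_castSucc]
  simp only [Fin.val_castSucc, Fin.val_last]
  refine add_le_add (le_of_eq ?_) ?_
  · rw [Finset.sum_congr rfl (g := fun _ => (1 : ℝ))]
    · simp
    · intro i _
      rw [hself i.val i.isLt, successProb, div_self (hpos _).ne', min_self]
  · rw [hlast, min_eq_right (by linarith), successProb, min_eq_right]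
    · exact div_le_div_of_nonneg_left (by linarith) (by linarith) hle
    · rw [div_le_one (by linarith)]
      linarith

/-- Lagrangian duality with resource price `1/b`: since `ν k < 1 ≤ b` for the first `l` arms, each
of them is best served exactly up to its threshold. Nothing relates `b` to the later thresholds, so
the bound can be used at different prices for the same instance. -/
theorem sum_successProb_le (hlK : l ≤ K) (hv_pos : ∀ k, 0 < v k) (hv_sum : ∑ k, v k < 1)
    (hν : ν ∈ instances K l v) {b : ℝ} (hb : 1 ≤ b) {M : Fin K → ℝ}
    (hM : ∑ k, M k ≤ 1) :
    ∑ k, successProb (ν k) (M k) ≤ l + (1 - ∑ i, v i) / b -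
      ∑ k, if l ≤ k.val then M k * (1 / b - 1 / ν k) else 0 := by
  have hb0 : 0 < b := by linarith
  have h : ∀ k : Fin K, successProb (ν k) (M k) ≤
      (if k.val < l then (1 : ℝ) else 0) - (if k.val < l then ν k else 0) / b + M k / b -
        (if l ≤ k.val then M k * (1 / b - 1 / ν k) else 0) := by
    intro k
    by_cases hk : k.val < l
    · have h0 := pos_of_mem_instances hv_pos hν k
      have h1 := lt_one_of_mem_instances hv_pos hv_sum hν hk
      simp only [hk, if_true, not_le.2 hk, if_false, sub_zero]
      rcases le_total (ν k) (M k) with h2 | h2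
      · have : ν k / b ≤ M k / b := by gcongr
        exact (min_le_left _ _).trans (by linarith)
      · have : (ν k - M k) / b ≤ (ν k - M k) / ν k :=
          div_le_div_of_nonneg_left (by linarith) h0 (by linarith)
        rw [sub_div, sub_div, div_self h0.ne'] at this
        exact (min_le_right _ _).trans (by linarith)
    · simp only [hk, if_false, not_lt.1 hk, if_true]
      refine (min_le_right _ _).trans (le_of_eq ?_)
      ring
  refine (Finset.sum_le_sum fun k _ => h k).trans ?_
  rw [Finset.sum_sub_distrib, Finset.sum_add_distrib, Finset.sum_sub_distrib, ← Finset.sum_div,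
    ← Finset.sum_div, sum_ite_eq_of_mem_instances hlK hν,
    ← sum_fin_eq_sum_ite hlK (fun _ => (1 : ℝ))]
  have : (∑ k, M k) / b ≤ 1 / b := by gcongr
  simp only [Finset.sum_const, Finset.card_univ, Fintype.card_fin, nsmul_eq_mul, mul_one]
  rw [sub_div]
  linarith

end Instances

/-! ### Relative entropy of Bernoulli laws -/

section Entropy

/-- Thinning by `M` cannot create more information than a fraction `M` of the original. This is the
log-sum inequality for the splitting `1 - M p = M (1 - p) + (1 - M)`, and likewise for `q`. -/
theorem bernoulliKL_mul_le {p q M : ℝ} (hp : 0 < p) (hp1 : p < 1) (hq : 0 < q) (hq1 : q < 1)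
    (hM : 0 ≤ M) (hM1 : M ≤ 1) : bernoulliKL (M * p) (M * q) ≤ M * bernoulliKL p q := by
  rcases hM.eq_or_lt with rfl | hM0
  · simp [bernoulliKL]
  have hMp : 0 < 1 - M * p := by nlinarith
  have hMq : 0 < 1 - M * q := by nlinarith
  have hu : 0 < (1 - M * p) / (1 - M * q) := div_pos hMp hMq
  unfold bernoulliKL
  rw [mul_div_mul_left _ _ hM0.ne']
  set u := (1 - M * p) / (1 - M * q) with hudef
  have hw : 0 < (1 - p) / (1 - q) := div_pos (by linarith) (by linarith)
  set w := (1 - p) / (1 - q) with hwdef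
  have h1 := Real.log_le_sub_one_of_pos hu
  have h2 := Real.log_le_sub_one_of_pos (div_pos hu hw)
  rw [Real.log_div hu.ne' hw.ne'] at h2
  have h3 : (1 - p) * (u / w) = u * (1 - q) := by
    rw [hwdef]; field_simp [(by linarith : (1 - p) ≠ 0)]
  have h4 : u * (1 - M * q) = 1 - M * p := div_mul_cancel₀ _ hMq.ne'
  have h5 := mul_le_mul_of_nonneg_left h2 (mul_nonneg hM (by linarith : 0 ≤ 1 - p))
  have h6 := mul_le_mul_of_nonneg_left h1 (by linarith : 0 ≤ 1 - M)
  have h7 : M * (1 - p) * (u / w - 1) = M * (u * (1 - q)) - M * (1 - p) := by rw [← h3]; ring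
  nlinarith

theorem bernoulliKL_pos {p q : ℝ} (hp : 0 < p) (hpq : p < q) (hq1 : q < 1) :
    0 < bernoulliKL p q := by
  have h1 := Real.log_lt_sub_one_of_pos (div_pos (hp.trans hpq) hp) (by
    rw [Ne, div_eq_one_iff_eq hp.ne']; exact hpq.ne')
  have h2 := Real.log_le_sub_one_of_pos
    (div_pos (by linarith : 0 < 1 - q) (by linarith : 0 < 1 - p))
  rw [← inv_div, Real.log_inv] at h1 h2
  have h3 := mul_lt_mul_of_pos_left h1 hp
  have h4 := mul_le_mul_of_nonneg_left h2 (by linarith : 0 ≤ 1 - p)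
  rw [inv_div, mul_sub, mul_div_cancel₀ _ hp.ne'] at h3
  rw [inv_div, mul_sub, mul_div_cancel₀ _ (by linarith : (1 - p) ≠ 0)] at h4
  unfold bernoulliKL
  linarith

/-- Apply `log x ≤ x - 1` to both logarithms; the result is exactly the chi-square divergence. -/
theorem bernoulliKL_le_chiSq {p q : ℝ} (hp : 0 < p) (hp1 : p < 1) (hq : 0 < q) (hq1 : q < 1) :
    bernoulliKL p q ≤ (q - p) ^ 2 / (q * (1 - q)) := by
  have h1 := Real.log_le_sub_one_of_pos (div_pos hp hq)
  have h2 := Real.log_le_sub_one_of_pos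
    (div_pos (by linarith : 0 < 1 - p) (by linarith : 0 < 1 - q))
  have h3 := mul_le_mul_of_nonneg_left h1 hp.le
  have h4 := mul_le_mul_of_nonneg_left h2 (by linarith : 0 ≤ 1 - p)
  have hq' : (1 - q) ≠ 0 := by linarith
  have : (q - p) ^ 2 / (q * (1 - q)) = p * (p / q - 1) + (1 - p) * ((1 - p) / (1 - q) - 1) := by
    field_simp
    ring
  unfold bernoulliKL
  linarith

/-- The first entry of the minimum suffices: with `x = 1 - a⁻¹`, the claim `4x² / (4x² + 1) ≤ x`
reduces to `x (2x - 1)² ≥ 0`. -/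
theorem factorC_le {a : ℝ} (ha : 0 ≤ 1 - a⁻¹) : factorC a ≤ 1 - a⁻¹ := by
  refine (min_le_left _ _).trans ?_
  rw [div_le_iff₀ (by positivity)]
  nlinarith [mul_nonneg ha (sq_nonneg (2 * (1 - a⁻¹) - 1))]

theorem factorC_mul_le {a b : ℝ} (ha : 1 < a) (hab : a < b) :
    factorC a * (b / (b - a)) ≤ (1 / a - 1 / b) / bernoulliKL (1 / b) (1 / a) := by
  have ha0 : 0 < a := by linarith
  have hb0 : 0 < b := by linarith
  have hp : 0 < 1 / b := by positivity
  have hpq : 1 / b < 1 / a := one_div_lt_one_div_of_lt ha0 hab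
  have hq1 : 1 / a < 1 := by rw [div_lt_one ha0]; exact ha
  have hD := bernoulliKL_pos hp hpq hq1
  have hle := bernoulliKL_le_chiSq hp (hpq.trans hq1) (hp.trans hpq) hq1
  rw [le_div_iff₀ hD]
  have hba : 0 < b - a := by linarith
  have ha1 : a - 1 ≠ 0 := by linarith
  have ha' : 0 ≤ 1 - a⁻¹ := by rw [← one_div]; linarith
  have h1 : factorC a * (b / (b - a)) ≤ (1 - a⁻¹) * (b / (b - a)) :=
    mul_le_mul_of_nonneg_right (factorC_le ha') (by positivity)
  have h2 : 0 ≤ (1 - a⁻¹) * (b / (b - a)) := by positivity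
  calc _ ≤ (1 - a⁻¹) * (b / (b - a)) * bernoulliKL (1 / b) (1 / a) :=
        mul_le_mul_of_nonneg_right h1 hD.le
    _ ≤ (1 - a⁻¹) * (b / (b - a)) * ((1 / a - 1 / b) ^ 2 / (1 / a * (1 - 1 / a))) :=
        mul_le_mul_of_nonneg_left hle h2
    _ = 1 / a - 1 / b := by
        have : b - a ≠ 0 := hba.ne'
        field_simp

end Entropy

/-! ### Path laws for a fixed seed -/

/-- The conditional probability, given the seed and the past `h`, of the outcomes `y` in
round `t`. -/
def roundProb {K : ℕ} {S : Type*} [MeasurableSpace S] (A : Algorithm K S) (ν : Fin K → ℝ) (s : S)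
    (t : ℕ) (h : Outcomes K t) (y : Fin K → Bool) : ℝ :=
  ∏ k, outcomeProb (ν k) (A.alloc t s h k) (y k)

/-- The conditional expectation, given the seed, of a function of the outcomes of the first `n`
rounds. -/
def pathMean {K : ℕ} {S : Type*} [MeasurableSpace S] (A : Algorithm K S) (ν : Fin K → ℝ) (s : S)
    {n : ℕ} (F : Outcomes K n → ℝ) : ℝ :=
  ∑ x, pathProb A ν s x * F x

/-- The total amount allocated to arm `k` in the first `n` rounds. -/
def totalAlloc {K : ℕ} {S : Type*} [MeasurableSpace S] (A : Algorithm K S) (k : Fin K) (s : S)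
    {n : ℕ} (x : Outcomes K n) : ℝ :=
  ∑ t : Fin n, A.alloc t.val s (x.before t) k

theorem outcomeProb_nonneg {ν M : ℝ} (hν : 0 < ν) (hM : 0 ≤ M) (b : Bool) :
    0 ≤ outcomeProb ν M b := by
  cases b
  · simp [outcomeProb, successProb]
  · simpa [outcomeProb] using successProb_nonneg hν hM

theorem sum_outcomeProb (ν M : ℝ) : ∑ b, outcomeProb ν M b = 1 := by
  simp [outcomeProb]

theorem sum_mul_prod_eq {K : ℕ} (o : Fin K → Bool → ℝ) (ho : ∀ k, ∑ b, o k b = 1) (j : Fin K)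
    (g : Bool → ℝ) :
    ∑ y : Fin K → Bool, (∏ k, o k (y k)) * g (y j) = ∑ b, o j b * g b := by
  -- Spreading `g` as a factor that is 1 off `j` turns the sum into a product of sums over single
  -- arms.
  have h : ∀ y : Fin K → Bool, (∏ k, o k (y k)) * g (y j) =
      ∏ k, o k (y k) * (if k = j then g (y k) else 1) := fun y => by
    rw [Finset.prod_mul_distrib, Finset.prod_ite_eq' Finset.univ j (fun k => g (y k))]
    simp
  simp_rw [h]
  rw [← Fintype.piFinset_univ,
    ← Finset.prod_univ_sum (fun _ => Finset.univ)
      (fun k b => o k b * (if k = j then g b else 1)),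
    Finset.prod_eq_single j]
  · simp
  · intro k _ hk
    simp only [hk, if_false, mul_one]
    exact ho k
  · simp

section Path

variable {K : ℕ} {S : Type*} [MeasurableSpace S] (A : Algorithm K S) (ν : Fin K → ℝ) (s : S)

theorem sum_roundProb_mul (t : ℕ) (h : Outcomes K t) (j : Fin K) (g : Bool → ℝ) :
    ∑ y, roundProb A ν s t h y * g (y j) =
      ∑ b, outcomeProb (ν j) (A.alloc t s h j) b * g b :=
  sum_mul_prod_eq (fun k => outcomeProb (ν k) (A.alloc t s h k)) (fun _ => sum_outcomeProb _ _) j g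

theorem sum_roundProb (t : ℕ) (h : Outcomes K t) : ∑ y, roundProb A ν s t h y = 1 := by
  simp only [roundProb]
  rw [← Fintype.piFinset_univ,
    ← Finset.prod_univ_sum (fun _ => Finset.univ)
      (fun k b => outcomeProb (ν k) (A.alloc t s h k) b)]
  exact Finset.prod_eq_one fun k _ => sum_outcomeProb _ _

theorem before_snoc_castSucc {n : ℕ} (x : Outcomes K n) (y : Fin K → Bool) (t : Fin n) :
    Outcomes.before (n := n + 1) (Fin.snoc (α := fun _ => Fin K → Bool) x y) t.castSucc =
      x.before t := by
  funext i
  exact Fin.snoc_castSucc (α := fun _ => Fin K → Bool) y x ⟨i.val, i.isLt.trans t.isLt⟩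

theorem before_snoc_last {n : ℕ} (x : Outcomes K n) (y : Fin K → Bool) :
    Outcomes.before (n := n + 1) (Fin.snoc (α := fun _ => Fin K → Bool) x y) (Fin.last n) = x := by
  funext i
  exact Fin.snoc_castSucc (α := fun _ => Fin K → Bool) y x i

theorem pathProb_snoc {n : ℕ} (x : Outcomes K n) (y : Fin K → Bool) :
    pathProb A ν s (n := n + 1) (Fin.snoc (α := fun _ => Fin K → Bool) x y) =
      pathProb A ν s x * roundProb A ν s n x y := by
  unfold pathProb
  rw [Fin.prod_univ_castSucc]
  simp only [before_snoc_castSucc, Fin.snoc_castSucc, Fin.snoc_last]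
  congr 1
  have := before_snoc_last x y
  simp only [roundProb]
  exact Finset.prod_congr rfl fun k _ => by
    rw [show A.alloc (Fin.last n).val s (Outcomes.before (n := n + 1)
      (Fin.snoc (α := fun _ => Fin K → Bool) x y) (Fin.last n)) = A.alloc n s x from
        congrArg (A.alloc n s) this]

theorem pathMean_succ {n : ℕ} (F : Outcomes K (n + 1) → ℝ) :
    pathMean A ν s F = pathMean A ν s fun x : Outcomes K n =>
      ∑ y, roundProb A ν s n x y * F (Fin.snoc (α := fun _ => Fin K → Bool) x y) := by
  unfold pathMean
  rw [← Equiv.sum_comp (Fin.snocEquiv fun _ : Fin (n + 1) => Fin K → Bool),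
    Fintype.sum_prod_type_right]
  refine Finset.sum_congr rfl fun x _ => ?_
  rw [Finset.mul_sum]
  refine Finset.sum_congr rfl fun y _ => ?_
  rw [← mul_assoc, ← pathProb_snoc]
  rfl

theorem pathMean_add {n : ℕ} (F G : Outcomes K n → ℝ) :
    pathMean A ν s (fun x => F x + G x) = pathMean A ν s F + pathMean A ν s G := by
  simp only [pathMean, mul_add, Finset.sum_add_distrib]

theorem pathMean_mul_left {n : ℕ} (c : ℝ) (F : Outcomes K n → ℝ) :
    pathMean A ν s (fun x => c * F x) = c * pathMean A ν s F := by
  simp only [pathMean, Finset.mul_sum]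
  exact Finset.sum_congr rfl fun x _ => by ring

theorem sum_pathProb (n : ℕ) : ∑ x : Outcomes K n, pathProb A ν s x = 1 := by
  have h : ∀ n : ℕ, pathMean A ν s (fun _ : Outcomes K n => 1) = 1 := by
    intro n
    induction n with
    | zero => simp [pathMean, pathProb]
    | succ n ih =>
      rw [pathMean_succ]
      simpa only [mul_one, sum_roundProb] using ih
  simpa [pathMean] using h n

theorem pathMean_const {n : ℕ} (c : ℝ) : pathMean A ν s (fun _ : Outcomes K n => c) = c := by
  rw [pathMean, ← Finset.sum_mul, sum_pathProb, one_mul]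

theorem alloc_le_one (t : ℕ) (x : Outcomes K t) (k : Fin K) : A.alloc t s x k ≤ 1 :=
  (Finset.single_le_sum (fun j _ => A.alloc_nonneg t s x j) (Finset.mem_univ k)).trans
    (A.sum_alloc_le_one t s x)

theorem totalAlloc_nonneg (k : Fin K) {n : ℕ} (x : Outcomes K n) : 0 ≤ totalAlloc A k s x :=
  Finset.sum_nonneg fun _ _ => A.alloc_nonneg _ _ _ _

theorem totalAlloc_le (k : Fin K) {n : ℕ} (x : Outcomes K n) : totalAlloc A k s x ≤ n := by
  simpa [totalAlloc] using Finset.sum_le_card_nsmul Finset.univ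
    (fun t : Fin n => A.alloc t.val s (x.before t) k) 1 fun t _ => alloc_le_one A s _ _ k

variable {ν}

theorem pathProb_nonneg (hν : ∀ k, 0 < ν k) {n : ℕ} (x : Outcomes K n) : 0 ≤ pathProb A ν s x :=
  Finset.prod_nonneg fun _ _ => Finset.prod_nonneg fun k _ =>
    outcomeProb_nonneg (hν k) (A.alloc_nonneg _ _ _ _) _

theorem pathMean_mono (hν : ∀ k, 0 < ν k) {n : ℕ} {F G : Outcomes K n → ℝ} (h : ∀ x, F x ≤ G x) :
    pathMean A ν s F ≤ pathMean A ν s G :=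
  Finset.sum_le_sum fun x _ => mul_le_mul_of_nonneg_left (h x) (pathProb_nonneg A s hν x)

theorem abs_pathMean_le (hν : ∀ k, 0 < ν k) {n : ℕ} {F : Outcomes K n → ℝ} {C : ℝ}
    (h : ∀ x, |F x| ≤ C) :
    |pathMean A ν s F| ≤ C := by
  rw [abs_le]
  constructor
  · calc -C = pathMean A ν s (fun _ : Outcomes K n => -C) := (pathMean_const A ν s _).symm
      _ ≤ _ := pathMean_mono A s hν fun x => (abs_le.1 (h x)).1
  · calc _ ≤ pathMean A ν s (fun _ : Outcomes K n => C) :=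
          pathMean_mono A s hν fun x => (abs_le.1 (h x)).2
      _ = C := pathMean_const A ν s _

/-- Bounds on the conditional means of the rounds add up. -/
theorem pathMean_sum_le (hν : ∀ k, 0 < ν k) {g : (t : ℕ) → Outcomes K t → (Fin K → Bool) → ℝ}
    {G : (t : ℕ) → Outcomes K t → ℝ}
    (h : ∀ t x, ∑ y, roundProb A ν s t x y * g t x y ≤ G t x) (n : ℕ) :
    pathMean A ν s (fun x : Outcomes K n => ∑ t : Fin n, g t.val (x.before t) (x t)) ≤
      pathMean A ν s (fun x : Outcomes K n => ∑ t : Fin n, G t.val (x.before t)) := by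
  induction n with
  | zero => simp
  | succ n ih =>
    rw [pathMean_succ, pathMean_succ]
    have e1 : ∀ (x : Outcomes K n) (y : Fin K → Bool),
        ∑ t : Fin (n + 1), g t.val
          (Outcomes.before (n := n + 1) (Fin.snoc (α := fun _ => Fin K → Bool) x y) t)
          (Fin.snoc (α := fun _ => Fin K → Bool) x y t) =
        ∑ t : Fin n, g t.val (x.before t) (x t) + g n x y := fun x y => by
      rw [Fin.sum_univ_castSucc]
      simp only [before_snoc_castSucc, Fin.snoc_castSucc, Fin.snoc_last]
      congr 1
      exact congrArg (fun z => g n z y) (before_snoc_last x y)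
    have e2 : ∀ (x : Outcomes K n) (y : Fin K → Bool),
        ∑ t : Fin (n + 1), G t.val
          (Outcomes.before (n := n + 1) (Fin.snoc (α := fun _ => Fin K → Bool) x y) t) =
        ∑ t : Fin n, G t.val (x.before t) + G n x := fun x y => by
      rw [Fin.sum_univ_castSucc]
      simp only [before_snoc_castSucc]
      congr 1
      exact congrArg (fun z => G n z) (before_snoc_last x y)
    simp only [e1, e2, mul_add, Finset.sum_add_distrib, ← Finset.sum_mul, sum_roundProb, one_mul]
    rw [pathMean_add, pathMean_add]
    exact add_le_add ih (pathMean_mono A s hν fun x => h n x)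

/-- The regret dominates the sum of lower bounds on the expected gaps of the rounds. -/
theorem pathMean_sum_le_regret (hν : ∀ k, 0 < ν k) {G : (t : ℕ) → Outcomes K t → ℝ}
    (h : ∀ t x, G t x ≤ optReward ν - ∑ k, successProb (ν k) (A.alloc t s x k)) (n : ℕ) :
    pathMean A ν s (fun x : Outcomes K n => ∑ t : Fin n, G t.val (x.before t)) ≤
      pathMean A ν s (fun x : Outcomes K n => regret ν x) := by
  have key := pathMean_sum_le A s hν
    (g := fun _ _ y => (∑ k, if y k then (1 : ℝ) else 0) - optReward ν)
    (G := fun t x => -G t x) (fun t x => ?_) n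
  · have e : ∀ x : Outcomes K n, regret ν x =
        (-1) * ∑ t : Fin n, ((∑ k, if x t k then (1 : ℝ) else 0) - optReward ν) := fun x => by
      rw [Finset.sum_sub_distrib]
      simp [regret]
    have e' : ∀ x : Outcomes K n, ∑ t : Fin n, -G t.val (x.before t) =
        (-1) * ∑ t : Fin n, G t.val (x.before t) := fun x => by
      rw [Finset.sum_neg_distrib]; ring
    simp only [e, pathMean_mul_left]
    simp only [e', pathMean_mul_left] at key
    linarith
  · have : ∑ y, roundProb A ν s t x y * ((∑ k, if y k then (1 : ℝ) else 0) - optReward ν) =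
        ∑ k, successProb (ν k) (A.alloc t s x k) - optReward ν := by
      simp only [mul_sub, Finset.sum_sub_distrib, ← Finset.sum_mul, sum_roundProb, one_mul,
        Finset.mul_sum]
      rw [Finset.sum_comm]
      congr 1
      refine Finset.sum_congr rfl fun k _ => ?_
      rw [sum_roundProb_mul A ν s t x k (fun b => if b then (1 : ℝ) else 0)]
      simp [outcomeProb]
    rw [this]
    linarith [h t x]

end Path

/-! ### Change of measure -/

/-- The logarithmic likelihood ratio of an outcome of an arm with the threshold `a` against the
threshold `b`. -/
def logRatio (a b M : ℝ) (y : Bool) : ℝ := Real.log (outcomeProb a M y / outcomeProb b M y)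

/-- Thresholds above 1 make failure always possible, so a probability vanishes only for a success
with `M = 0`, and then for both thresholds. The two laws are thus mutually absolutely continuous. -/
theorem outcomeProb_mul_exp_neg_logRatio {a b M : ℝ} (ha : 1 < a) (hb : 1 < b) (hM : 0 ≤ M)
    (hM1 : M ≤ 1) (y : Bool) :
    outcomeProb b M y = outcomeProb a M y * Real.exp (-logRatio a b M y) := by
  have key : (outcomeProb a M y = 0 ∧ outcomeProb b M y = 0) ∨
      (0 < outcomeProb a M y ∧ 0 < outcomeProb b M y) := by
    cases y
    · right
      have h : ∀ c : ℝ, 1 < c → 0 < outcomeProb c M false := fun c hc => by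
        have : M / c < 1 := by rw [div_lt_one (by linarith)]; linarith
        simpa [outcomeProb, successProb] using this
      exact ⟨h a ha, h b hb⟩
    · rcases hM.eq_or_lt with rfl | hM0
      · left; simp [outcomeProb, successProb]
      · right
        have h : ∀ c : ℝ, 1 < c → 0 < outcomeProb c M true := fun c hc => by
          have : 0 < M / c := div_pos hM0 (by linarith)
          simpa [outcomeProb, successProb] using this
        exact ⟨h a ha, h b hb⟩
  rcases key with ⟨h1, h2⟩ | ⟨h1, h2⟩
  · rw [h1, h2, zero_mul]
  · rw [logRatio, ← Real.log_inv, Real.exp_log (inv_pos.2 (div_pos h1 h2)), inv_div,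
      mul_div_cancel₀ _ h1.ne']

/-- As `M ≤ 1` lies below both thresholds, the cap in `successProb` is inactive and the left side is
the relative entropy of two thinned Bernoulli laws. -/
theorem sum_outcomeProb_mul_logRatio_le {a b M : ℝ} (ha : 1 < a) (hb : 1 < b) (hM : 0 ≤ M)
    (hM1 : M ≤ 1) :
    ∑ y, outcomeProb a M y * logRatio a b M y ≤ M * bernoulliKL (1 / a) (1 / b) := by
  have h : ∀ c : ℝ, 1 < c → successProb c M = M * (1 / c) := fun c hc => by
    rw [successProb, min_eq_right ((div_le_one (by linarith)).2 (by linarith))]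
    ring
  have h' : ∀ c : ℝ, 1 < c → 0 < 1 / c ∧ 1 / c < 1 := fun c hc =>
    ⟨by positivity, (div_lt_one (by linarith)).2 hc⟩
  refine le_trans (le_of_eq ?_)
    (bernoulliKL_mul_le (h' a ha).1 (h' a ha).2 (h' b hb).1 (h' b hb).2 hM hM1)
  simp [outcomeProb, logRatio, bernoulliKL, h a ha, h b hb]

section ChangeOfMeasure

variable {K : ℕ} {S : Type*} [MeasurableSpace S] (A : Algorithm K S) {ν : Fin K → ℝ} (s : S)

theorem pathProb_update {k : Fin K} {b : ℝ} (hk : 1 < ν k) (hb : 1 < b) {n : ℕ}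
    (x : Outcomes K n) :
    pathProb A (Function.update ν k b) s x = pathProb A ν s x *
      Real.exp (-∑ t : Fin n, logRatio (ν k) b (A.alloc t.val s (x.before t) k) (x t k)) := by
  unfold pathProb
  rw [← Finset.sum_neg_distrib, Real.exp_sum, ← Finset.prod_mul_distrib]
  refine Finset.prod_congr rfl fun t _ => ?_
  rw [← Finset.mul_prod_erase _ _ (Finset.mem_univ k),
    ← Finset.mul_prod_erase Finset.univ
      (fun j => outcomeProb (ν j) (A.alloc t.val s (x.before t) j) (x t j)) (Finset.mem_univ k),
    Function.update_self,
    outcomeProb_mul_exp_neg_logRatio hk hb (A.alloc_nonneg _ _ _ _) (alloc_le_one A s _ _ k)]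
  have : ∏ j ∈ Finset.univ.erase k, outcomeProb (Function.update ν k b j)
        (A.alloc t.val s (x.before t) j) (x t j) =
      ∏ j ∈ Finset.univ.erase k, outcomeProb (ν j) (A.alloc t.val s (x.before t) j) (x t j) :=
    Finset.prod_congr rfl fun j hj => by rw [Function.update_of_ne (Finset.ne_of_mem_erase hj)]
  rw [this]
  ring

theorem exp_mul_le_of_mem_Icc {c w : ℝ} (hw : 0 ≤ w) (hw1 : w ≤ 1) :
    Real.exp (c * w) ≤ 1 + Real.exp c * w := by
  have := convexOn_exp.2 (Set.mem_univ c) (Set.mem_univ 0) hw (by linarith : 0 ≤ 1 - w) (by ring)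
  simp only [smul_eq_mul, mul_zero, add_zero, Real.exp_zero, mul_one] at this
  rw [mul_comm c w]
  linarith

/-- A variational bound: an variable `W` that is unlikely for the modified threshold
forces arm `k` to be observed. -/
theorem mul_pathMean_le (hν : ∀ k, 0 < ν k) {k : Fin K} {b : ℝ} (hk : 1 < ν k) (hb : 1 < b)
    {n : ℕ} {W : Outcomes K n → ℝ} (hW : ∀ x, 0 ≤ W x) (hW1 : ∀ x, W x ≤ 1) (c : ℝ) :
    c * pathMean A ν s W ≤
      bernoulliKL (1 / ν k) (1 / b) * pathMean A ν s (fun x : Outcomes K n => totalAlloc A k s x)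
        + Real.log 2 + Real.exp c * pathMean A (Function.update ν k b) s W / 2 := by
  set L : Outcomes K n → ℝ := fun x =>
    ∑ t : Fin n, logRatio (ν k) b (A.alloc t.val s (x.before t) k) (x t k) with hL
  have hKL : pathMean A ν s L ≤ bernoulliKL (1 / ν k) (1 / b) *
      pathMean A ν s (fun x : Outcomes K n => totalAlloc A k s x) := by
    rw [← pathMean_mul_left]
    simp only [totalAlloc, Finset.mul_sum]
    refine pathMean_sum_le A s hν
      (g := fun t x y => logRatio (ν k) b (A.alloc t s x k) (y k))
      (G := fun t x => bernoulliKL (1 / ν k) (1 / b) * A.alloc t s x k) (fun t x => ?_) n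
    rw [sum_roundProb_mul A ν s t x k (fun y => logRatio (ν k) b (A.alloc t s x k) y), mul_comm]
    exact sum_outcomeProb_mul_logRatio_le hk hb (A.alloc_nonneg _ _ _ _) (alloc_le_one A s _ _ k)
  have hpt : ∀ x : Outcomes K n, pathProb A ν s x * (c * W x) ≤
      pathProb A ν s x * L x + pathProb A ν s x * (Real.log 2 - 1) +
        (pathProb A (Function.update ν k b) s x +
          Real.exp c * (pathProb A (Function.update ν k b) s x * W x)) / 2 := fun x => by
    -- The tangent at 2 replaces the logarithm in the Donsker–Varadhan formula. The bound becomes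
    -- linear in the modified path law, so it can be summed over paths and later integrated over the
    -- seed.
    have h1 := Real.add_one_le_exp (c * W x - L x - Real.log 2)
    rw [Real.exp_sub, Real.exp_log two_pos, sub_eq_add_neg (c * W x), Real.exp_add] at h1
    have h2 := exp_mul_le_of_mem_Icc (c := c) (hW x) (hW1 x)
    have h3 := mul_le_mul_of_nonneg_right h2 (Real.exp_pos (-L x)).le
    have h4 : c * W x ≤ L x + (Real.log 2 - 1) + (1 + Real.exp c * W x) * Real.exp (-L x) / 2 := by
      linarith
    have h5 := mul_le_mul_of_nonneg_left h4 (pathProb_nonneg A s hν x)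
    rw [pathProb_update A s hk hb x]
    linarith
  have hsum := Finset.sum_le_sum fun x (_ : x ∈ Finset.univ) => hpt x
  rw [Finset.sum_add_distrib, Finset.sum_add_distrib, ← Finset.sum_mul, ← Finset.sum_div,
    Finset.sum_add_distrib, ← Finset.mul_sum, sum_pathProb, sum_pathProb] at hsum
  have h6 := pathMean_mul_left A ν s c W
  unfold pathMean at *
  linarith

end ChangeOfMeasure

/-! ### Averaging over the seed -/

/-- The expected total amount allocated to arm `k` in the first `n` rounds. -/
def expectedAlloc {K : ℕ} {S : Type*} [MeasurableSpace S] (A : Algorithm K S) (ρ : Measure S)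
    (ν : Fin K → ℝ) (k : Fin K) (n : ℕ) : ℝ :=
  ∫ s, pathMean A ν s (fun x : Outcomes K n => totalAlloc A k s x) ∂ρ

section Integrate

variable {K : ℕ} {S : Type*} [MeasurableSpace S] (A : Algorithm K S) (ρ : Measure S)
  [IsProbabilityMeasure ρ] {ν : Fin K → ℝ}

theorem measurable_outcomeProb (a : ℝ) (b : Bool) : Measurable fun M => outcomeProb a M b := by
  unfold outcomeProb successProb
  cases b <;> simp <;> fun_prop

theorem measurable_pathProb (ν : Fin K → ℝ) {n : ℕ} (x : Outcomes K n) :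
    Measurable fun s => pathProb A ν s x := by
  unfold pathProb
  exact Finset.measurable_prod _ fun t _ => Finset.measurable_prod _ fun k _ =>
    (measurable_outcomeProb _ _).comp (A.measurable_alloc _ _ _)

theorem integrable_pathMean (hν : ∀ k, 0 < ν k) {n : ℕ} {F : S → Outcomes K n → ℝ}
    (hF : ∀ x, Measurable fun s => F s x) {C : ℝ} (hC : ∀ s x, |F s x| ≤ C) :
    Integrable (fun s => pathMean A ν s (F s)) ρ := by
  refine Integrable.of_bound (C := C) ?_ (Eventually.of_forall fun s =>
    abs_pathMean_le A s hν (hC s))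
  exact (Finset.measurable_sum _ fun x _ =>
    (measurable_pathProb A ν x).mul (hF x)).aestronglyMeasurable

theorem integrable_pathMean_totalAlloc (hν : ∀ k, 0 < ν k) (k : Fin K) (n : ℕ) :
    Integrable (fun s => pathMean A ν s (fun x : Outcomes K n => totalAlloc A k s x)) ρ := by
  refine integrable_pathMean A ρ hν (F := fun s x => totalAlloc A k s x) (C := n) (fun x => ?_)
    fun s x => ?_
  · exact Finset.measurable_sum _ fun t _ => A.measurable_alloc _ _ _
  · rw [abs_of_nonneg (totalAlloc_nonneg A s k x)]
    exact totalAlloc_le A s k x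

theorem integrable_pathMean_regret (hν : ∀ k, 0 < ν k) (n : ℕ) :
    Integrable (fun s => pathMean A ν s (fun x : Outcomes K n => regret ν x)) ρ :=
  integrable_pathMean A ρ hν (F := fun _ x => regret ν x)
    (C := ∑ x : Outcomes K n, |regret ν x|) (fun _ => measurable_const) fun _ x =>
    Finset.single_le_sum (f := fun x => |regret ν x|) (fun _ _ => abs_nonneg _)
      (Finset.mem_univ x)

end Integrate

/-! ### Regret and allocation at a fixed horizon -/

section LowerBound

variable {K l : ℕ} {v : Fin l → ℝ} {ν : Fin K → ℝ}

theorem exists_eq_minRest (hlK : l < K) (ν : Fin K → ℝ) :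
    ∃ k : Fin K, l ≤ k.val ∧ ν k = minRest l ν := by
  have : Nonempty {k : Fin K // l ≤ k.val} := ⟨⟨⟨l, hlK⟩, le_rfl⟩⟩
  obtain ⟨k, hk⟩ := exists_eq_ciInf_of_finite (f := fun k : {k : Fin K // l ≤ k.val} => ν k)
  exact ⟨k, k.2, hk⟩

theorem minRest_le (ν : Fin K → ℝ) {k : Fin K} (hk : l ≤ k.val) : minRest l ν ≤ ν k :=
  ciInf_le (f := fun k : {k : Fin K // l ≤ k.val} => ν k) (Set.finite_range _).bddBelow ⟨k, hk⟩

theorem one_lt_minRest (hlK : l < K) (hν : ν ∈ instances K l v) : 1 < minRest l ν := by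
  obtain ⟨k, hk, he⟩ := exists_eq_minRest hlK ν
  rw [← he]
  exact hν.2 k hk

theorem update_mem_instances (hν : ν ∈ instances K l v) {k : Fin K} (hk : l ≤ k.val) {b : ℝ}
    (hb : 1 < b) : Function.update ν k b ∈ instances K l v := by
  refine ⟨fun j hj => ?_, fun j hj => ?_⟩
  · rw [Function.update_of_ne (by rintro rfl; omega)]
    exact hν.1 j hj
  · rcases eq_or_ne j k with rfl | h
    · rwa [Function.update_self]
    · rw [Function.update_of_ne h]
      exact hν.2 j hj

variable {S : Type*} [MeasurableSpace S] (A : Algorithm K S) (ρ : Measure S)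
  [IsProbabilityMeasure ρ]

/-- Combine `le_optReward` at a minimizing arm with `sum_successProb_le` at the price `1 / minRest l
ν`; arms attaining the minimum contribute zero. -/
theorem sum_gap_mul_expectedAlloc_le (hlK : l < K) (hv_pos : ∀ k, 0 < v k)
    (hv_sum : ∑ k, v k < 1) (hν : ν ∈ instances K l v) (n : ℕ) :
    ∑ k : Fin K with l ≤ k.val ∧ minRest l ν < ν k,
      (1 / minRest l ν - 1 / ν k) * expectedAlloc A ρ ν k n ≤ expectedRegret A ρ ν n := by
  have hpos := pos_of_mem_instances hv_pos hν
  have h1 := one_lt_minRest hlK hν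
  obtain ⟨k₀, hk₀, he⟩ := exists_eq_minRest hlK ν
  unfold expectedAlloc
  simp only [← integral_const_mul]
  rw [← integral_finsetSum _ fun k _ =>
    (integrable_pathMean_totalAlloc A ρ hpos k n).const_mul _]
  refine integral_mono (integrable_finsetSum _ fun k _ =>
    (integrable_pathMean_totalAlloc A ρ hpos k n).const_mul _)
    (integrable_pathMean_regret A ρ hpos n) fun s => ?_
  have key := pathMean_sum_le_regret A s hpos
    (G := fun t x => ∑ k : Fin K with l ≤ k.val ∧ minRest l ν < ν k,
      (1 / minRest l ν - 1 / ν k) * A.alloc t s x k) (fun t x => ?_) n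
  · refine le_trans (le_of_eq ?_) key
    simp only [pathMean, totalAlloc, Finset.mul_sum]
    rw [Finset.sum_comm]
    refine Finset.sum_congr rfl fun x _ => ?_
    rw [Finset.sum_comm]
    exact Finset.sum_congr rfl fun t _ => Finset.sum_congr rfl fun k _ => by ring
  · have h2 := le_optReward hv_pos hv_sum hν k₀ hk₀
    have h3 := sum_successProb_le hlK.le hv_pos hv_sum hν h1.le (A.sum_alloc_le_one t s x)
    have h4 : ∑ k : Fin K with l ≤ k.val ∧ minRest l ν < ν k,
        (1 / minRest l ν - 1 / ν k) * A.alloc t s x k =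
        ∑ k, if l ≤ k.val then A.alloc t s x k * (1 / minRest l ν - 1 / ν k) else 0 := by
      rw [Finset.sum_filter]
      refine Finset.sum_congr rfl fun k _ => ?_
      by_cases hk : l ≤ k.val
      · rcases (minRest_le ν hk).eq_or_lt with h | h
        · simp [← h]
        · simp [hk, h, mul_comm]
      · simp [hk]
    rw [he] at h2
    rw [h4]
    linarith

/-- The variational bound for the normalized shortfall of arm `k`, averaged over the seed. The
parameter `c` is left free so that it can grow with `log n`. -/
theorem mul_one_sub_le (hv_pos : ∀ k, 0 < v k) (hv_sum : ∑ k, v k < 1)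
    (hν : ν ∈ instances K l v) {k : Fin K} (hk : l ≤ k.val)
    {b : ℝ} (hb : 1 < b) (hb' : b < minRest l ν) {n : ℕ} (hn : 0 < n) {c : ℝ} (hc : 0 ≤ c) :
    c * (1 - expectedAlloc A ρ ν k n / (n * (1 - ∑ i, v i))) ≤
      bernoulliKL (1 / ν k) (1 / b) * expectedAlloc A ρ ν k n + Real.log 2 +
        Real.exp c * expectedRegret A ρ (Function.update ν k b) n /
          (2 * (n * (1 - ∑ i, v i)) * (1 / b - 1 / minRest l ν)) := by
  have hlK : l < K := hk.trans_lt k.isLt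
  set R := 1 - ∑ i, v i with hR
  have hR0 : 0 < R := by linarith
  have hn0 : (0 : ℝ) < n := by exact_mod_cast hn
  have hnR : 0 < n * R := by positivity
  have ha := one_lt_minRest hlK hν
  set a := minRest l ν with hadef
  set ν' := Function.update ν k b with hν'def
  have hν' : ν' ∈ instances K l v := update_mem_instances hν hk hb
  have hpos := pos_of_mem_instances hv_pos hν
  have hpos' := pos_of_mem_instances hv_pos hν'
  set δ := 1 / b - 1 / a with hδ
  have hδ0 : 0 < δ := sub_pos.2 (one_div_lt_one_div_of_lt (by linarith) hb')
  have hseed : ∀ s, c * (1 - pathMean A ν s (fun x : Outcomes K n => totalAlloc A k s x) / (n * R))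
      ≤ bernoulliKL (1 / ν k) (1 / b) *
          pathMean A ν s (fun x : Outcomes K n => totalAlloc A k s x) + Real.log 2 +
        Real.exp c * pathMean A ν' s (fun x : Outcomes K n => regret ν' x) /
          (2 * (n * R) * δ) := fun s => by
    set W : Outcomes K n → ℝ := fun x =>
      (n * R)⁻¹ * ∑ t : Fin n, max 0 (R - A.alloc t.val s (x.before t) k) with hW
    have hW0 : ∀ x, 0 ≤ W x := fun x => mul_nonneg (inv_nonneg.2 hnR.le)
      (Finset.sum_nonneg fun _ _ => le_max_left _ _)
    have hW1 : ∀ x, W x ≤ 1 := fun x => by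
      rw [hW]
      simp only
      rw [inv_mul_le_one₀ hnR]
      have : ∑ t : Fin n, max 0 (R - A.alloc t.val s (x.before t) k) ≤ ∑ _t : Fin n, R :=
        Finset.sum_le_sum fun t _ => max_le hR0.le
          (by linarith [A.alloc_nonneg t.val s (x.before t) k])
      simpa using this
    have hWlow : 1 - pathMean A ν s (fun x : Outcomes K n => totalAlloc A k s x) / (n * R) ≤
        pathMean A ν s W := by
      have h := pathMean_mono A s hpos
        (F := fun x : Outcomes K n => 1 + (-(n * R)⁻¹) * totalAlloc A k s x) (G := W) fun x => by
          have : ∑ t : Fin n, (R - A.alloc t.val s (x.before t) k) ≤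
              ∑ t : Fin n, max 0 (R - A.alloc t.val s (x.before t) k) :=
            Finset.sum_le_sum fun t _ => le_max_right _ _
          rw [Finset.sum_sub_distrib] at this
          simp only [Finset.sum_const, Finset.card_univ, Fintype.card_fin, nsmul_eq_mul] at this
          have h2 := mul_le_mul_of_nonneg_left this (inv_nonneg.2 hnR.le)
          rw [mul_sub, inv_mul_cancel₀ hnR.ne'] at h2
          simp only [hW, totalAlloc]
          linarith
      rw [pathMean_add, pathMean_const, pathMean_mul_left] at h
      rw [div_eq_inv_mul]
      linarith
    have hWup : pathMean A ν' s W ≤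
        pathMean A ν' s (fun x : Outcomes K n => regret ν' x) / (n * R * δ) := by
      -- Under `ν'` a round that gives arm `k` less than `R` loses at least `δ` per missing unit,
      -- because any other later arm yields at most `1/a` per unit instead of `1/b`.
      have h := pathMean_sum_le_regret A s hpos'
        (G := fun t x => δ * max 0 (R - A.alloc t s x k)) (fun t x => ?_) n
      · have e : W = fun x => (n * R * δ)⁻¹ *
            ∑ t : Fin n, δ * max 0 (R - A.alloc t.val s (x.before t) k) := by
          funext x
          rw [← Finset.mul_sum, ← mul_assoc, mul_inv, inv_mul_cancel_right₀ hδ0.ne']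
        rw [e, pathMean_mul_left, div_eq_inv_mul]
        exact mul_le_mul_of_nonneg_left h (by positivity)
      · have hopt := le_optReward hv_pos hv_sum hν' k hk
        rw [show ν' k = b from Function.update_self ..] at hopt
        have hval : ∀ j : Fin K, j ≠ k → ν' j = ν j := fun j hj => Function.update_of_ne hj ..
        have hvk : ν' k = b := Function.update_self ..
        have hM := A.alloc_nonneg t s x
        rw [mul_max_of_nonneg _ _ hδ0.le, mul_zero]
        refine max_le ?_ ?_
        -- At the price `1/b` every later arm has a nonnegative penalty, so the gap is nonnegative.
        · have h1 := sum_successProb_le hlK.le hv_pos hv_sum hν' hb.le (A.sum_alloc_le_one t s x)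
          have h2 : 0 ≤ ∑ j, if l ≤ j.val then A.alloc t s x j * (1 / b - 1 / ν' j) else 0 := by
            refine Finset.sum_nonneg fun j _ => ?_
            split_ifs with hj
            · refine mul_nonneg (hM j) (sub_nonneg.2 (one_div_le_one_div_of_le (by linarith) ?_))
              rcases eq_or_ne j k with rfl | h
              · exact hvk.ge
              · rw [hval j h]; exact hb'.le.trans (minRest_le ν hj)
            · exact le_rfl
          linarith
        -- At the price `1/a` the term of arm `k` is negative, and it provides the bound that is
        -- linear in the shortfall.
        · have h1 := sum_successProb_le hlK.le hv_pos hv_sum hν' ha.le (A.sum_alloc_le_one t s x)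
          have h2 : A.alloc t s x k * (1 / a - 1 / b) ≤
              ∑ j, if l ≤ j.val then A.alloc t s x j * (1 / a - 1 / ν' j) else 0 := by
            rw [← Finset.add_sum_erase _ _ (Finset.mem_univ k), if_pos hk, hvk]
            refine le_add_of_nonneg_right (Finset.sum_nonneg fun j hj => ?_)
            split_ifs with hj'
            · rw [hval j (Finset.ne_of_mem_erase hj)]
              exact mul_nonneg (hM j) (sub_nonneg.2 (one_div_le_one_div_of_le (by linarith)
                (minRest_le ν hj')))
            · exact le_rfl
          have h3 : δ * (R - A.alloc t s x k) =
              R / b - R / a + A.alloc t s x k * (1 / a - 1 / b) := by rw [hδ]; ring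
          linarith
    have h := mul_pathMean_le A s hpos (hν.2 k hk) hb hW0 hW1 c
    have h2 := mul_le_mul_of_nonneg_left hWlow hc
    have h3 := mul_le_mul_of_nonneg_left hWup (Real.exp_pos c).le
    have h4 : Real.exp c * pathMean A ν' s (fun x : Outcomes K n => regret ν' x) /
        (2 * (n * R) * δ) = Real.exp c *
          (pathMean A ν' s (fun x : Outcomes K n => regret ν' x) / (n * R * δ)) / 2 := by
      field_simp
    rw [h4]
    linarith
  have hiT := integrable_pathMean_totalAlloc A ρ hpos k n
  have hiR := integrable_pathMean_regret A ρ hpos' n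
  have hi₁ : Integrable (fun s => bernoulliKL (1 / ν k) (1 / b) *
      pathMean A ν s (fun x : Outcomes K n => totalAlloc A k s x) + Real.log 2) ρ :=
    (hiT.const_mul _).add (integrable_const _)
  have hi₂ : Integrable (fun s => Real.exp c *
      pathMean A ν' s (fun x : Outcomes K n => regret ν' x) / (2 * (n * R) * δ)) ρ :=
    (hiR.const_mul _).div_const _
  have hint := integral_mono
    (((integrable_const (μ := ρ) (1 : ℝ)).sub (hiT.div_const (n * R))).const_mul c)
    (hi₁.add hi₂) hseed
  simp only [Pi.add_apply, Pi.sub_apply] at hint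
  rw [integral_const_mul, integral_sub (integrable_const _) (hiT.div_const _), integral_div,
    integral_add hi₁ hi₂, integral_add (hiT.const_mul _) (integrable_const _),
    integral_const_mul, integral_div, integral_const_mul] at hint
  simp only [integral_const, probReal_univ, one_smul] at hint
  exact hint

end LowerBound

/-! ### Logarithmic growth of the allocations -/

section Asymptotics

variable {K l : ℕ} {v : Fin l → ℝ} {ν : Fin K → ℝ} {S : Type*} [MeasurableSpace S]
  (A : Algorithm K S) (ρ : Measure S) [IsProbabilityMeasure ρ]

theorem eventually_le_expectedAlloc_div_log (hv_pos : ∀ k, 0 < v k)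
    (hv_sum : ∑ k, v k < 1)
    (hA : ∀ ν ∈ instances K l v, ∀ a : ℝ, 0 < a →
      Tendsto (fun n : ℕ => expectedRegret A ρ ν n / (n : ℝ) ^ a) atTop (𝓝 0))
    (hν : ν ∈ instances K l v) {k : Fin K} (hk : l ≤ k.val) (hgap : minRest l ν < ν k) {c : ℝ}
    (hc : c < 1 / bernoulliKL (1 / ν k) (1 / minRest l ν)) :
    ∀ᶠ n : ℕ in atTop, c ≤ expectedAlloc A ρ ν k n / Real.log n := by
  have hlK : l < K := hk.trans_lt k.isLt
  have ha := one_lt_minRest hlK hν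
  set a := minRest l ν with hadef
  have ha0 : 0 < a := by linarith
  have hpos := pos_of_mem_instances hv_pos hν
  have hp : 0 < 1 / ν k := one_div_pos.2 (hpos k)
  have hD : 0 < bernoulliKL (1 / ν k) (1 / a) :=
    bernoulliKL_pos hp (one_div_lt_one_div_of_lt ha0 hgap) ((div_lt_one ha0).2 ha)
  have hcont : ContinuousAt (fun x : ℝ => c * bernoulliKL (1 / ν k) (1 / x)) a := by
    have h1 : (1 : ℝ) - 1 / a ≠ 0 := by
      have : 1 / a < 1 := (div_lt_one ha0).2 ha
      linarith
    have h2 : 1 - 1 / ν k ≠ 0 := by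
      have : 1 / ν k < 1 := (div_lt_one (hpos k)).2 (ha.trans hgap)
      linarith
    have hne : 1 / ν k / (1 / a) ≠ 0 := by positivity
    have hne' : (1 - 1 / ν k) / (1 - 1 / a) ≠ 0 := div_ne_zero h2 h1
    unfold bernoulliKL
    have hi : ContinuousAt (fun x : ℝ => 1 / x) a := continuousAt_const.div continuousAt_id ha0.ne'
    exact continuousAt_const.mul ((continuousAt_const.mul
      ((continuousAt_const.div hi (by positivity)).log hne)).add (continuousAt_const.mul
      ((continuousAt_const.div (continuousAt_const.sub hi) h1).log hne')))
  have hlt : c * bernoulliKL (1 / ν k) (1 / a) < 1 := (lt_div_iff₀ hD).1 hc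
  -- The instance with `ν k = a` would leave no gap `δ`; continuity of the entropy allows `b`
  -- strictly below `a`.
  obtain ⟨b, hbD, hb, hb'⟩ : ∃ b, c * bernoulliKL (1 / ν k) (1 / b) < 1 ∧ 1 < b ∧ b < a := by
    have h1 : ∀ᶠ x in 𝓝[<] a, c * bernoulliKL (1 / ν k) (1 / x) < 1 :=
      (hcont.eventually_lt_const hlt).filter_mono nhdsWithin_le_nhds
    have h2 : ∀ᶠ x in 𝓝[<] a, 1 < x := (eventually_gt_nhds ha).filter_mono nhdsWithin_le_nhds
    obtain ⟨b, h⟩ := (h1.and (h2.and self_mem_nhdsWithin)).exists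
    exact ⟨b, h.1, h.2.1, h.2.2⟩
  set D := bernoulliKL (1 / ν k) (1 / b) with hDdef
  have hD' : 0 < D :=
    bernoulliKL_pos hp (one_div_lt_one_div_of_lt (by linarith) (hb'.trans hgap))
      ((div_lt_one (by linarith)).2 hb)
  -- `β > c D` leaves room for a contradiction, and `β < 1` makes `1 - β` an admissible exponent for
  -- the regret. The maximum with 0 covers nonpositive `c`.
  obtain ⟨β, hβ, hβ1⟩ := exists_between (max_lt hbD zero_lt_one)
  obtain ⟨hβD, hβ0⟩ := max_lt_iff.1 hβ
  set R := 1 - ∑ i, v i with hR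
  have hR0 : 0 < R := by linarith
  set ν' := Function.update ν k b with hν'def
  have hreg := hA ν' (update_mem_instances hν hk hb) (1 - β) (by linarith)
  set δ := 1 / b - 1 / a with hδ
  have hδ0 : 0 < δ := sub_pos.2 (one_div_lt_one_div_of_lt (by linarith) hb')
  have hlog : Tendsto (fun n : ℕ => Real.log n) atTop atTop :=
    Real.tendsto_log_atTop.comp tendsto_natCast_atTop_atTop
  have hlogn : Tendsto (fun n : ℕ => Real.log n / n) atTop (𝓝 0) := by
    have := Real.isLittleO_log_id_atTop.tendsto_div_nhds_zero.comp
      (tendsto_natCast_atTop_atTop (R := ℝ))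
    exact this
  have hleft : Tendsto (fun n : ℕ => β - (Real.log 2 +
      expectedRegret A ρ ν' n / (n : ℝ) ^ (1 - β) / (2 * R * δ)) / Real.log n) atTop (𝓝 β) := by
    have h1 := (tendsto_const_nhds (x := Real.log 2)).add (hreg.div_const (2 * R * δ))
    simpa using (tendsto_const_nhds (x := β)).sub (h1.div_atTop hlog)
  have hright : Tendsto (fun n : ℕ => c * (D + β / R * (Real.log n / n))) atTop (𝓝 (c * D)) := by
    simpa using ((hlogn.const_mul (β / R)).const_add D).const_mul c
  filter_upwards [hleft.eventually_const_lt (u := (c * D + β) / 2) (by linarith),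
    hright.eventually_lt_const (u := (c * D + β) / 2) (by linarith),
    hlog.eventually_gt_atTop 0, eventually_gt_atTop 0,
    (hlogn.const_mul (β / R)).const_add D |>.eventually_const_lt (u := 0) (by simpa using hD')]
    with n h1 h2 hlog0 hn hDn
  have hn0 : (0 : ℝ) < n := by exact_mod_cast hn
  by_contra! hcon
  -- With this parameter `exp` gives `n ^ β`, and dividing by `n` leaves the regret over `n ^ (1 -
  -- β)`, which tends to 0.
  have h := mul_one_sub_le A ρ hv_pos hv_sum hν hk hb hb' hn (c := β * Real.log n) (by positivity)
  rw [← hR, ← hDdef, ← hν'def, ← hδ] at h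
  set T := expectedAlloc A ρ ν k n with hT
  set Q := expectedRegret A ρ ν' n with hQ
  have hexp : Real.exp (β * Real.log n) * Q / (2 * (n * R) * δ) =
      Q / (n : ℝ) ^ (1 - β) / (2 * R * δ) := by
    rw [Real.rpow_sub hn0, Real.rpow_one, mul_comm β, ← Real.rpow_def_of_pos hn0]
    have : (n : ℝ) ^ β ≠ 0 := (Real.rpow_pos_of_pos hn0 _).ne'
    field_simp
  rw [hexp] at h
  set E := Real.log 2 + Q / (n : ℝ) ^ (1 - β) / (2 * R * δ) with hE
  have h3 : β - E / Real.log n ≤ T / Real.log n * (D + β / R * (Real.log n / n)) := by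
    have e1 : β - E / Real.log n = (β * Real.log n - E) / Real.log n := by
      field_simp
    have e2 : T / Real.log n * (D + β / R * (Real.log n / n)) =
        (D * T + β * Real.log n * (T / (n * R))) / Real.log n := by
      field_simp
    rw [e1, e2]
    gcongr
    linarith
  have h4 : T / Real.log n * (D + β / R * (Real.log n / n)) ≤
      c * (D + β / R * (Real.log n / n)) :=
    mul_le_mul_of_nonneg_right hcon.le hDn.le
  linarith

end Asymptotics
end Allocation

end

/-! ### The two lower bounds -/

open Allocation
theorem theorem4 {S : Type*} [MeasurableSpace S] (ρ : Measure S) [IsProbabilityMeasure ρ]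
    (K l : ℕ) (hK : l + 1 < K) (v : Fin l → ℝ) (hv_pos : ∀ k, 0 < v k) (hv_sum : ∑ k, v k < 1)
    (A : Algorithm K S)
    (hA : ∀ ν ∈ instances K l v, ∀ a : ℝ, 0 < a →
      Tendsto (fun n : ℕ => expectedRegret A ρ ν n / (n : ℝ) ^ a) atTop (𝓝 0)) :
    ∀ ν ∈ instances K l v,
      ((∑ k : Fin K with l ≤ k.val ∧ minRest l ν < ν k,
          (1 / minRest l ν - 1 / ν k) / bernoulliKL (1 / ν k) (1 / minRest l ν) : ℝ) : EReal)
        ≤ liminf (fun n : ℕ => ((expectedRegret A ρ ν n / Real.log n : ℝ) : EReal)) atTop ∧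
      factorC (minRest l ν) *
          ∑ k : Fin K with l ≤ k.val ∧ ν k ≠ minRest l ν, ν k / (ν k - minRest l ν)
        ≤ ∑ k : Fin K with l ≤ k.val ∧ minRest l ν < ν k,
          (1 / minRest l ν - 1 / ν k) / bernoulliKL (1 / ν k) (1 / minRest l ν) := by
  intro ν hν
  have hlK : l < K := by omega
  have h1 := one_lt_minRest hlK hν
  refine ⟨?_, ?_⟩
  -- A common factor `c < 1` for the finitely many arms lets their eventual bounds be added; `c → 1`
  -- is taken after the liminf.
  · have hlow : ∀ c < (1 : ℝ), ∀ᶠ n : ℕ in atTop,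
        c * (∑ k : Fin K with l ≤ k.val ∧ minRest l ν < ν k,
          (1 / minRest l ν - 1 / ν k) / bernoulliKL (1 / ν k) (1 / minRest l ν)) ≤
        expectedRegret A ρ ν n / Real.log n := by
      intro c hc
      have hev : ∀ᶠ n : ℕ in atTop, ∀ k : Fin K, l ≤ k.val → minRest l ν < ν k →
          c * (1 / bernoulliKL (1 / ν k) (1 / minRest l ν)) ≤
            expectedAlloc A ρ ν k n / Real.log n := by
        rw [eventually_all]
        intro k
        by_cases hk : l ≤ k.val ∧ minRest l ν < ν k
        · have hk0 := one_div_lt_one_div_of_lt (by linarith) hk.2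
          have hD := bernoulliKL_pos (one_div_pos.2 (by linarith [hk.2])) hk0
            ((div_lt_one (by linarith)).2 h1)
          filter_upwards [eventually_le_expectedAlloc_div_log A ρ hv_pos hv_sum hA hν hk.1 hk.2
            (mul_lt_of_lt_one_left (one_div_pos.2 hD) hc)] with n hn _ _ using hn
        · exact Eventually.of_forall fun n h h' => absurd ⟨h, h'⟩ hk
      filter_upwards [hev] with n hn
      refine le_trans ?_ (div_le_div_of_nonneg_right
        (sum_gap_mul_expectedAlloc_le A ρ hlK hv_pos hv_sum hν n) (Real.log_natCast_nonneg n))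
      rw [Finset.mul_sum, Finset.sum_div]
      refine Finset.sum_le_sum fun k hk => ?_
      obtain ⟨hk1, hk2⟩ := (Finset.mem_filter.1 hk).2
      have hg : 0 ≤ 1 / minRest l ν - 1 / ν k :=
        sub_nonneg.2 (one_div_le_one_div_of_le (by linarith) hk2.le)
      calc _ = (1 / minRest l ν - 1 / ν k) *
            (c * (1 / bernoulliKL (1 / ν k) (1 / minRest l ν))) := by ring
        _ ≤ (1 / minRest l ν - 1 / ν k) * (expectedAlloc A ρ ν k n / Real.log n) :=
          mul_le_mul_of_nonneg_left (hn k hk1 hk2) hg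
        _ = _ := by ring
    set V := ∑ k : Fin K with l ≤ k.val ∧ minRest l ν < ν k,
          (1 / minRest l ν - 1 / ν k) / bernoulliKL (1 / ν k) (1 / minRest l ν) with hV
    have hlim : Tendsto (fun c : ℝ => ((c * V : ℝ) : EReal)) (𝓝[<] 1) (𝓝 (V : EReal)) := by
      have : Tendsto (fun c : ℝ => c * V) (𝓝[<] 1) (𝓝 (1 * V)) :=
        ((continuous_id.mul continuous_const).tendsto 1).mono_left nhdsWithin_le_nhds
      rw [one_mul] at this
      exact (continuous_coe_real_ereal.tendsto _).comp this
    refine le_of_tendsto hlim ?_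
    filter_upwards [self_mem_nhdsWithin] with c hc
    -- In `EReal` the liminf needs no boundedness of the regret ratio.
    refine le_liminf_of_le (by isBoundedDefault) ?_
    filter_upwards [hlow c hc] with n hn using EReal.coe_le_coe_iff.2 hn
  · have hfilter : (Finset.univ.filter fun k : Fin K => l ≤ k.val ∧ ν k ≠ minRest l ν) =
        Finset.univ.filter fun k : Fin K => l ≤ k.val ∧ minRest l ν < ν k := by
      refine Finset.filter_congr fun k _ => and_congr_right fun hk => ?_
      exact ⟨fun h => lt_of_le_of_ne (minRest_le ν hk) h.symm, fun h => h.ne'⟩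
    rw [hfilter, Finset.mul_sum]
    exact Finset.sum_le_sum fun k hk =>
      factorC_mul_le h1 (Finset.mem_filter.1 hk).2.2
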